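/- Let $n\ge 0$ and $N\ge 1$ be integers and let $A=(A_1,\dots,A_n)$ be an $n$-tuple of complex $N\times N$ matrices which is hyperbolic, i.e. for every $\xi\in\mathbb R^n$ the spectrum of $\langle\xi,A\rangle=\sum_{j=1}^n\xi_jA_j$ is contained in $\mathbb R$. Let $\|\cdot\|$ be the operator norm of matrices induced by the Euclidean norm on $\mathbb C^N$, put $\|A\|=\big(\sum_{j=1}^n\|A_j\|^2\big)^{1/2}$, let $|\cdot|$ be the Euclidean norm on $\mathbb R^n$, and write $\langle\zeta,A\rangle=\sum_{j=1}^n\zeta_jA_j$ for $\zeta\in\mathbb C^n$. Then: (1) For every $r>\|A\|$ there is a constant $C>0$ such that $$\big\|e^{i\langle\zeta,A\rangle}\big\|\le C\,(1+|\xi|)^{N-1}e^{r|\eta|}\qquad\text{for all }\zeta=\xi+i\eta,\ \xi,\eta\in\mathbb R^n .$$ (2) The Weyl functional calculus $\mathcal W_A$ of $A$ exists: with $\hat f(\xi)=\int_{\mathbb R^n}e^{-i\langle x,\xi\rangle}f(x)\,dx$, for every Schwartz function $f\in\mathcal S(\mathbb R^n)$ the integral $$\langle\mathcal W_A,f\rangle=\frac1{(2\pi)^n}\int_{\mathbb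 R^n}e^{i\langle\xi,A\rangle}\hat f(\xi)\,d\xi$$ converges absolutely, and $f\mapsto\langle\mathcal W_A,f\rangle$ is a matrix-valued tempered distribution on $\mathbb R^n$. Moreover $\mathcal W_A$ has compact support, and for every $r>\|A\|$ its support is contained in the closed ball of radius $r$ centred at $0$. -/

import Mathlib

open scoped Matrix.Norms.L2Operator SchwartzMap

noncomputable section

namespace WeylCalculus

/-- The linear combination `⟨A, ζ⟩ = ∑ j, ζ_j A_j` of an `n`-tuple of matrices, for `ζ ∈ ℂⁿ`. -/
def pairing {n N : ℕ} (A : Fin n → Matrix (Fin N) (Fin N) ℂ) (ζ : Fin n → ℂ) :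
    Matrix (Fin N) (Fin N) ℂ :=
  ∑ j, ζ j • A j

/-- The tuple `A` is hyperbolic: every real linear combination of the `A_j` has real spectrum. -/
def IsHyperbolic {n N : ℕ} (A : Fin n → Matrix (Fin N) (Fin N) ℂ) : Prop :=
  ∀ ξ : Fin n → ℝ, spectrum ℂ (pairing A fun j => (ξ j : ℂ)) ⊆ Set.range ((↑) : ℝ → ℂ)

/-- The norm `‖A‖ = (∑ j, ‖A_j‖²)^{1/2}` of a tuple of matrices; `‖A_j‖` is the operator norm
induced by the Euclidean norm of `ℂᴺ`. -/
def tupleNorm {n N : ℕ} (A : Fin n → Matrix (Fin N) (Fin N) ℂ) : ℝ :=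
  Real.sqrt (∑ j, ‖A j‖ ^ 2)

/-- The Fourier transform `f̂(ξ) = ∫ e^{-i⟨x, ξ⟩} f(x) dx`. -/
def fourierHat {n : ℕ} (f : 𝓢(EuclideanSpace ℝ (Fin n), ℂ)) (ξ : EuclideanSpace ℝ (Fin n)) : ℂ :=
  ∫ x, Complex.exp (-(Complex.I * (inner ℝ x ξ : ℝ))) * f x

/-- The function `ξ ↦ f̂(ξ) e^{i⟨A, ξ⟩}`. -/
def weylIntegrand {n N : ℕ} (A : Fin n → Matrix (Fin N) (Fin N) ℂ)
    (f : 𝓢(EuclideanSpace ℝ (Fin n), ℂ)) (ξ : EuclideanSpace ℝ (Fin n)) :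
    Matrix (Fin N) (Fin N) ℂ :=
  fourierHat f ξ • NormedSpace.exp (Complex.I • pairing A fun j => (ξ j : ℂ))

/-- The matrix-valued tempered distribution `W` is the Weyl functional calculus of `A`: the
integral `(2π)⁻ⁿ ∫ e^{i⟨A, ξ⟩} f̂(ξ) dξ` converges absolutely and equals `W f`, for every Schwartz
function `f`. -/
def IsWeylCalculus {n N : ℕ} (A : Fin n → Matrix (Fin N) (Fin N) ℂ)
    (W : 𝓢'(EuclideanSpace ℝ (Fin n), Matrix (Fin N) (Fin N) ℂ)) : Prop :=
  ∀ f : 𝓢(EuclideanSpace ℝ (Fin n), ℂ),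
    MeasureTheory.Integrable (weylIntegrand A f) ∧
      W f = ((2 * Real.pi : ℂ) ^ n)⁻¹ • ∫ ξ, weylIntegrand A f ξ

end WeylCalculus

end

open WeylCalculus

open WeylCalculus

section

open Complex Set MeasureTheory LineDeriv
open scoped Matrix.Norms.L2Operator SchwartzMap

/-! ### Bounds for exponentials in a Banach algebra. -/

section BanachAlgebra

variable {𝔸 : Type*} [NormedRing 𝔸] [NormedAlgebra ℂ 𝔸] [CompleteSpace 𝔸]

/-! A matrix `B` with real eigenvalues is annihilated by a product of `N` factors `B - l` with `l`
real (Cayley–Hamilton). Peeling off one factor at a time bounds `e^{iB}` by `N (1 + 2‖B‖)^(N-1)`: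
each factor costs one integration over `[0, 1]`, and the phases have modulus one
(`norm_exp_mul_le_of_prod_mul_eq_zero`). So `e^{i⟨ξ,A⟩}` grows polynomially on `ℝⁿ`.
Phragmén–Lindelöf on the complex line through `ξ` in direction `η` carries this to `ℂⁿ` at the price
of `e^{‖A‖|η|}`, and the leftover powers of `|η|` are absorbed by enlarging `‖A‖` to `r`.

Polynomial growth on `ℝⁿ` makes the Weyl integral converge and depend continuously on `f`. The
support is located as in Paley–Wiener: if `f` is supported where `⟨x,ω⟩ ≥ ρ > r > ‖A‖`, shifting the
integration to `ℝⁿ - itω` leaves the integral unchanged but bounds it by a multiple of `e^{(r-ρ)t}`,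
which tends to `0` (`integral_weylIntegrand_eq_zero`). -/

theorem norm_exp_smul_sub_algebraMap_mul (B Y : 𝔸) (l t : ℝ) :
    ‖NormedSpace.exp (t • (I • (B - algebraMap ℂ 𝔸 l))) * Y‖ =
      ‖NormedSpace.exp (t • (I • B)) * Y‖ := by
  have h : t • (I • (B - algebraMap ℂ 𝔸 l)) = t • (I • B) + algebraMap ℂ 𝔸 ((-(t * l) : ℝ) * I) := by
    rw [Algebra.algebraMap_eq_smul_one, Algebra.algebraMap_eq_smul_one,
      ← Complex.coe_smul, ← Complex.coe_smul, smul_sub, smul_sub, sub_eq_add_neg, smul_smul, smul_smul,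
      smul_smul, ← neg_smul]
    congr 2
    push_cast
    ring
  let _ : NormedAlgebra ℚ 𝔸 := NormedAlgebra.restrictScalars ℚ ℂ 𝔸
  rw [h, NormedSpace.exp_add_of_commute (Algebra.commutes _ _).symm, ← NormedSpace.algebraMap_exp_comm,
    ← Algebra.commutes, Algebra.algebraMap_eq_smul_one, smul_one_mul, smul_mul_assoc, norm_smul,
    ← Complex.exp_eq_exp_ℂ, Complex.norm_exp_ofReal_mul_I, one_mul]

/-- Induction on the list, with `X` free: `e^{s i(B-l)} X` has derivative `e^{s i(B-l)} i(B-l)X`,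
and `(B-l)X` is killed by the shorter product. Since `l` is real, replacing `B - l` by `B` in the
exponent changes no norm, so the induction hypothesis bounds the derivative. -/
theorem norm_exp_mul_le_of_prod_mul_eq_zero (B : 𝔸) {b : ℝ} (hb : 0 ≤ b) (L : List ℝ) :
    (∀ l ∈ L, ‖B - algebraMap ℂ 𝔸 l‖ ≤ b) → ∀ X : 𝔸,
      (L.map fun l : ℝ => B - algebraMap ℂ 𝔸 l).prod * X = 0 → ∀ t ∈ Icc (0 : ℝ) 1,
      ‖NormedSpace.exp (t • (I • B)) * X‖ ≤ L.length * (1 + b) ^ (L.length - 1) * ‖X‖ := by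
  induction L with
  | nil => intro _ X hX t _; simp at hX; simp [hX]
  | cons l L ih =>
    intro hL X hX t ht
    simp only [List.map_cons, List.prod_cons] at hX
    have hcomm : Commute (B - algebraMap ℂ 𝔸 l) (L.map fun l : ℝ => B - algebraMap ℂ 𝔸 l).prod := by
      refine Commute.list_prod_right _ _ fun y hy => ?_
      obtain ⟨m, -, rfl⟩ := List.mem_map.1 hy
      exact ((Commute.refl B).sub_right (Algebra.commutes _ _).symm).sub_left
        (Algebra.commutes _ _)
    rw [hcomm.eq, mul_assoc] at hX
    have hY := ih (fun m hm => hL m (List.mem_cons_of_mem _ hm)) _ hX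
    set C : 𝔸 := I • (B - algebraMap ℂ 𝔸 l) with hC
    set K : ℝ := L.length * (1 + b) ^ (L.length - 1) * (b * ‖X‖) with hK
    have hder : ∀ s ∈ Icc (0 : ℝ) t, HasDerivWithinAt (fun s : ℝ => NormedSpace.exp (s • C) * X)
        (NormedSpace.exp (s • C) * C * X) (Icc 0 t) s := fun s _ =>
      ((hasDerivAt_exp_smul_const C s).mul_const X).hasDerivWithinAt
    have hbd : ∀ s ∈ Ico (0 : ℝ) t, ‖NormedSpace.exp (s • C) * C * X‖ ≤ K := by
      intro s hs
      rw [hC, mul_assoc, norm_exp_smul_sub_algebraMap_mul, smul_mul_assoc, mul_smul_comm, norm_smul,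
        Complex.norm_I, one_mul]
      refine (hY s ⟨hs.1, hs.2.le.trans ht.2⟩).trans ?_
      rw [hK]
      gcongr
      exact (norm_mul_le _ _).trans
        (mul_le_mul_of_nonneg_right (hL l List.mem_cons_self) (norm_nonneg _))
    have hmv := norm_image_sub_le_of_norm_deriv_le_segment' hder hbd t ⟨ht.1, le_rfl⟩
    have hK0 : 0 ≤ K := by positivity
    rw [← norm_exp_smul_sub_algebraMap_mul B X l t, ← hC]
    simp only [zero_smul, NormedSpace.exp_zero, one_mul, sub_zero] at hmv
    have h1 : ‖NormedSpace.exp (t • C) * X‖ ≤ ‖X‖ + K := by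
      have := norm_le_norm_add_norm_sub' (NormedSpace.exp (t • C) * X) X
      nlinarith [ht.2]
    refine h1.trans ?_
    have h2 : K ≤ L.length * (1 + b) ^ L.length * ‖X‖ := by
      rw [hK]
      -- For the empty list the truncated exponent is harmless, as the factor `L.length` vanishes.
      rcases Nat.eq_zero_or_pos L.length with h0 | h0
      · simp [h0]
      · obtain ⟨m, hm⟩ := Nat.exists_eq_succ_of_ne_zero h0.ne'
        rw [hm, Nat.succ_sub_one, pow_succ, ← mul_assoc, ← mul_assoc]
        gcongr
        linarith
    have h3 : ‖X‖ ≤ (1 + b) ^ L.length * ‖X‖ :=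
      le_mul_of_one_le_left (norm_nonneg _) (one_le_pow₀ (by linarith))
    simp only [List.length_cons, Nat.cast_add, Nat.cast_one, Nat.add_sub_cancel]
    linarith

theorem NormedSpace.norm_exp_le_exp_norm {𝔹 : Type*} [NormedRing 𝔹] [NormedAlgebra ℂ 𝔹]
    [NormOneClass 𝔹] (x : 𝔹) :
    ‖NormedSpace.exp x‖ ≤ Real.exp ‖x‖ := by
  rw [NormedSpace.exp_eq_tsum ℂ, Real.exp_eq_exp_ℝ, NormedSpace.exp_eq_tsum ℝ]
  refine tsum_of_norm_bounded (NormedSpace.expSeries_summable' (𝕂 := ℝ) ‖x‖).hasSum fun n => ?_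
  rw [norm_smul, norm_inv, RCLike.norm_natCast, smul_eq_mul]
  gcongr
  exact norm_pow_le _ _

theorem differentiable_exp_add_smul (X Y : 𝔸) :
    Differentiable ℂ fun w : ℂ => NormedSpace.exp (X + w • Y) := by
  intro w
  have h : AnalyticAt ℂ (NormedSpace.exp : 𝔸 → 𝔸) (X + w • Y) := NormedSpace.exp_analytic _
  exact h.differentiableAt.comp w (by fun_prop)

/-- The Phragmén–Lindelöf principle for `w ↦ exp (iX - wY)` in the right half-plane. -/
theorem norm_exp_sub_smul_le_of_forall_real [NormOneClass 𝔸] (X Y : 𝔸) {K R : ℝ} (hR : 1 ≤ R)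
    (k : ℕ)
    (h : ∀ x : ℝ, ‖NormedSpace.exp (I • (X + (x : ℂ) • Y))‖ ≤ K * (R + |x|) ^ k) {t : ℝ}
    (ht : 0 ≤ t) :
    ‖NormedSpace.exp (I • (X + (I * t) • Y))‖ ≤ K * 2 ^ k * (R + t) ^ k * Real.exp (‖Y‖ * t) := by
  have hK : 0 ≤ K := by
    have := (norm_nonneg _).trans (h 0)
    have hp : 0 < (R + |(0 : ℝ)|) ^ k := by simp; positivity
    exact nonneg_of_mul_nonneg_left this hp
  -- The exponential is normalised to be bounded on the positive real axis by `e^{-‖Y‖w}`, and on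
  -- the imaginary axis by `(w + R)^{-k}`, whose pole lies in the left half-plane.
  set F : ℂ → 𝔸 := fun w => (Complex.exp (-(‖Y‖ * w)) * ((w + R) ^ k)⁻¹) •
    NormedSpace.exp (I • X + w • (-Y)) with hF
  have hne : ∀ w : ℂ, 0 ≤ w.re → 1 ≤ ‖w + R‖ := fun w hw => by
    refine le_trans ?_ (Complex.re_le_norm _)
    simp; linarith
  have hdiff : ∀ w : ℂ, 0 ≤ w.re → DifferentiableAt ℂ F w := fun w hw => by
    have h0 : w + R ≠ 0 := norm_pos_iff.1 (zero_lt_one.trans_le (hne w hw))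
    have h1 : DifferentiableAt ℂ (fun w : ℂ => ((w + R) ^ k)⁻¹) w :=
      DifferentiableAt.inv (by fun_prop) (pow_ne_zero _ h0)
    have h2 : DifferentiableAt ℂ (fun w : ℂ => Complex.exp (-(‖Y‖ * w))) w := by fun_prop
    exact (h2.mul h1).smul (differentiable_exp_add_smul _ _ w)
  have hnorm : ∀ w : ℂ, ‖F w‖ = Real.exp (-(‖Y‖ * w.re)) * (‖w + R‖ ^ k)⁻¹ *
      ‖NormedSpace.exp (I • X + w • (-Y))‖ := fun w => by
    simp [hF, norm_smul, Complex.norm_exp]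
  have hle : ∀ w : ℂ, 0 ≤ w.re → ‖F w‖ ≤ Real.exp (-(‖Y‖ * w.re)) * Real.exp (‖X‖ + ‖w‖ * ‖Y‖) := by
    intro w hw
    rw [hnorm]
    have h1 : (‖w + R‖ ^ k)⁻¹ ≤ 1 := inv_le_one_of_one_le₀ (one_le_pow₀ (hne w hw))
    have h2 : ‖NormedSpace.exp (I • X + w • (-Y))‖ ≤ Real.exp (‖X‖ + ‖w‖ * ‖Y‖) := by
      refine (NormedSpace.norm_exp_le_exp_norm _).trans (Real.exp_le_exp.2 ?_)
      refine (norm_add_le _ _).trans_eq ?_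
      simp [norm_smul]
    calc _ ≤ Real.exp (-(‖Y‖ * w.re)) * 1 * Real.exp (‖X‖ + ‖w‖ * ‖Y‖) := by gcongr
      _ = _ := by rw [mul_one]
  have key : ‖F t‖ ≤ K * 2 ^ k := by
    refine PhragmenLindelof.right_half_plane_of_bounded_on_real (f := F) (z := (t : ℂ)) ?_ ?_ ?_ ?_
      (by simpa using ht)
    · refine DifferentiableOn.diffContOnCl fun w hw => ?_
      rw [Complex.closure_setOfPred_lt_re] at hw
      exact (hdiff w hw).differentiableWithinAt
    · refine ⟨1, one_lt_two, ‖Y‖, Asymptotics.IsBigO.of_bound (Real.exp ‖X‖) ?_⟩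
      refine Filter.eventually_inf_principal.2 (Filter.Eventually.of_forall fun w hw => ?_)
      have hw : 0 < w.re := hw
      refine (hle w hw.le).trans ?_
      rw [Real.norm_of_nonneg (Real.exp_pos _).le, ← Real.exp_add, ← Real.exp_add, Real.rpow_one]
      refine Real.exp_le_exp.2 ?_
      nlinarith [norm_nonneg Y]
    · refine Filter.isBoundedUnder_of_eventually_le (a := Real.exp ‖X‖) ?_
      filter_upwards [Filter.eventually_ge_atTop (0 : ℝ)] with x hx
      refine (hle x (by simpa using hx)).trans ?_
      rw [← Real.exp_add]
      refine Real.exp_le_exp.2 ?_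
      simp [abs_of_nonneg hx]
      linarith
    · intro x
      rw [hnorm]
      have h1 : I • X + ((x : ℂ) * I) • (-Y) = I • (X + ((-x : ℝ) : ℂ) • Y) := by
        rw [smul_add, smul_smul, smul_neg, ← neg_smul]; congr 2; push_cast; ring
      -- This halving is the source of the factor `2 ^ k`.
      have h2 : (R + |x|) / 2 ≤ ‖(x : ℂ) * I + R‖ := by
        have ha := Complex.abs_re_le_norm ((x : ℂ) * I + R)
        have hb := Complex.abs_im_le_norm ((x : ℂ) * I + R)
        simp at ha hb
        have := le_abs_self R
        linarith
      have h3 := h (-x)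
      rw [abs_neg] at h3
      have hpos : 0 < (R + |x|) / 2 := by positivity
      rw [h1]
      simp only [mul_re, ofReal_re, I_re, mul_zero, ofReal_im, I_im, mul_one, sub_self, neg_zero,
        Real.exp_zero, one_mul]
      calc _ ≤ (((R + |x|) / 2) ^ k)⁻¹ * (K * (R + |x|) ^ k) := by gcongr
        _ = K * 2 ^ k := by rw [div_pow]; field_simp
  rw [hnorm] at key
  have h1 : I • (X + (I * t) • Y) = I • X + (t : ℂ) • (-Y) := by
    rw [smul_add, smul_smul, smul_neg, ← neg_smul]; congr 2; rw [← mul_assoc, I_mul_I]; ring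
  have h2 : ‖(t : ℂ) + R‖ = R + t := by
    rw [← Complex.ofReal_add, Complex.norm_of_nonneg (by linarith), add_comm]
  rw [h2, ofReal_re, Real.exp_neg, ← mul_inv, inv_mul_le_iff₀ (by positivity)] at key
  rw [h1]
  linarith

end BanachAlgebra

/-- Cayley–Hamilton supplies the annihilating product, and eigenvalues satisfy `|l| ≤ ‖B‖`, whence
`b = 2‖B‖`. -/
theorem Matrix.norm_exp_I_smul_le {N : ℕ} (hN : 1 ≤ N) (B : Matrix (Fin N) (Fin N) ℂ)
    (hB : spectrum ℂ B ⊆ Set.range ((↑) : ℝ → ℂ)) :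
    ‖NormedSpace.exp (I • B)‖ ≤ N * (1 + 2 * ‖B‖) ^ (N - 1) := by
  have : NeZero N := ⟨by omega⟩
  have hroot : ∀ z ∈ B.charpoly.roots, z ∈ spectrum ℂ B := fun z hz => by
    rw [Matrix.mem_spectrum_iff_isRoot_charpoly]
    exact Polynomial.isRoot_of_mem_roots hz
  set L : List ℝ := B.charpoly.roots.toList.map Complex.re with hL
  have hmem : ∀ l ∈ L, (l : ℂ) ∈ spectrum ℂ B := by
    intro l hl
    obtain ⟨z, hz, rfl⟩ := List.mem_map.1 hl
    have hz := hroot z (Multiset.mem_toList.1 hz)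
    obtain ⟨x, rfl⟩ := hB hz
    simpa using hz
  have hlen : L.length = N := by
    rw [hL, List.length_map, Multiset.length_toList,
      IsAlgClosed.card_roots_eq_natDegree, Matrix.charpoly_natDegree_eq_dim, Fintype.card_fin]
  have hprod : (L.map fun l : ℝ => B - algebraMap ℂ _ (l : ℂ)).prod = 0 := by
    have h1 : B.charpoly = (B.charpoly.roots.toList.map fun z => Polynomial.X - Polynomial.C z).prod := by
      have := (IsAlgClosed.splits B.charpoly).eq_prod_roots_of_monic B.charpoly_monic
      conv_lhs => rw [this]
      conv_lhs => rw [← Multiset.coe_toList B.charpoly.roots]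
      rw [Multiset.map_coe, Multiset.prod_coe]
    have h2 := Matrix.aeval_self_charpoly B
    rw [h1, map_list_prod, List.map_map] at h2
    rw [hL, List.map_map]
    rw [← h2]
    congr 1
    refine List.map_congr_left fun z hz => ?_
    obtain ⟨x, rfl⟩ := hB (hroot z (Multiset.mem_toList.1 hz))
    simp
  have hnorm : ∀ l ∈ L, ‖B - algebraMap ℂ _ (l : ℂ)‖ ≤ 2 * ‖B‖ := by
    intro l hl
    refine (norm_sub_le _ _).trans ?_
    rw [norm_algebraMap']
    have := spectrum.norm_le_norm_of_mem (hmem l hl)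
    linarith
  have := norm_exp_mul_le_of_prod_mul_eq_zero B (by positivity) L hnorm 1
    (by rw [hprod, zero_mul]) 1 ⟨zero_le_one, le_rfl⟩
  rw [hlen, one_smul] at this
  simpa using this

/-! ### Growth of `e^{i⟨ζ,A⟩}` for hyperbolic tuples. -/

section Pairing

variable {n N : ℕ} (A : Fin n → Matrix (Fin N) (Fin N) ℂ)

theorem tupleNorm_nonneg : 0 ≤ tupleNorm A := Real.sqrt_nonneg _

theorem pairing_add_smul (ξ ω : Fin n → ℂ) (z : ℂ) :
    pairing A (ξ + z • ω) = pairing A ξ + z • pairing A ω := by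
  simp [pairing, add_smul, Finset.sum_add_distrib, Finset.smul_sum, smul_smul]

theorem norm_pairing_ofReal_le (ξ : EuclideanSpace ℝ (Fin n)) :
    ‖pairing A fun j => (ξ j : ℂ)‖ ≤ tupleNorm A * ‖ξ‖ := by
  refine (norm_sum_le _ _).trans ?_
  rw [tupleNorm, EuclideanSpace.norm_eq, ← Real.sqrt_mul (by positivity)]
  refine Real.le_sqrt_of_sq_le ?_
  have := Finset.sum_mul_sq_le_sq_mul_sq Finset.univ (fun j => ‖A j‖) (fun j => ‖ξ j‖)
  refine le_trans (le_of_eq ?_) this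
  congr 1
  exact Finset.sum_congr rfl fun j _ => by rw [norm_smul, mul_comm]; simp

variable {A}

theorem WeylCalculus.IsHyperbolic.norm_exp_pairing_le (hN : 1 ≤ N) (hA : IsHyperbolic A)
    (ξ : EuclideanSpace ℝ (Fin n)) :
    ‖NormedSpace.exp (I • pairing A fun j => (ξ j : ℂ))‖ ≤
      N * (1 + 2 * tupleNorm A) ^ (N - 1) * (1 + ‖ξ‖) ^ (N - 1) := by
  refine (Matrix.norm_exp_I_smul_le hN _ (hA ξ)).trans ?_
  rw [mul_assoc, ← mul_pow]
  have h1 := norm_pairing_ofReal_le A ξ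
  have h2 := tupleNorm_nonneg A
  have h3 := norm_nonneg ξ
  gcongr
  nlinarith

/-- Absorbs the powers of `|η|` into the gap `δ = r - ‖A‖`. -/
theorem pow_mul_exp_le {δ : ℝ} (hδ : 0 < δ) (k : ℕ) {t : ℝ} (ht : 0 ≤ t) :
    (1 + t) ^ k ≤ (1 + k / δ) ^ k * Real.exp (δ * t) := by
  rcases Nat.eq_zero_or_pos k with rfl | hk
  · simpa using by positivity
  have hk' : (0 : ℝ) < k := by exact_mod_cast hk
  have h1 : 1 + t ≤ (1 + k / δ) * Real.exp (δ * t / k) := by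
    have := Real.add_one_le_exp (δ * t / k)
    have h2 : t = k / δ * (δ * t / k) := by field_simp
    have h3 : 0 ≤ δ * t / k := by positivity
    have h4 : 0 < k / δ := by positivity
    calc 1 + t = 1 + k / δ * (δ * t / k) := by rw [← h2]
      _ ≤ (1 + k / δ) * (δ * t / k + 1) := by nlinarith
      _ ≤ _ := by gcongr
  calc (1 + t) ^ k ≤ ((1 + k / δ) * Real.exp (δ * t / k)) ^ k := by gcongr
    _ = _ := by
      rw [mul_pow, ← Real.exp_nat_mul]
      congr 2
      field_simp

theorem WeylCalculus.IsHyperbolic.exists_norm_exp_pairing_le (hN : 1 ≤ N) (hA : IsHyperbolic A) {r : ℝ}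
    (hr : tupleNorm A < r) : ∃ C : ℝ, 0 < C ∧ ∀ ξ η : EuclideanSpace ℝ (Fin n),
      ‖NormedSpace.exp (I • pairing A fun j => (ξ j : ℂ) + I * (η j : ℂ))‖
          ≤ C * (1 + ‖ξ‖) ^ (N - 1) * Real.exp (r * ‖η‖) := by
  have : NeZero N := ⟨by omega⟩
  have hA0 := tupleNorm_nonneg A
  set k := N - 1
  set K : ℝ := N * (1 + 2 * tupleNorm A) ^ k with hK
  have hN' : (0 : ℝ) < N := by exact_mod_cast hN
  have hK0 : 0 < K := by positivity
  set δ := r - tupleNorm A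
  have hδ : 0 < δ := sub_pos.2 hr
  refine ⟨K * 2 ^ k * (1 + k / δ) ^ k, by positivity, fun ξ η => ?_⟩
  -- For `η = 0` this `ω` is `0`, so only `‖ω‖ ≤ 1` is asked.
  obtain ⟨ω, hω, hη⟩ : ∃ ω : EuclideanSpace ℝ (Fin n), ‖ω‖ ≤ 1 ∧ η = ‖η‖ • ω := by
    refine ⟨‖η‖⁻¹ • η, ?_, ?_⟩
    · rw [norm_smul, norm_inv, norm_norm]; exact inv_mul_le_one
    · rcases eq_or_ne η 0 with rfl | h
      · simp
      · rw [smul_smul, mul_inv_cancel₀ (norm_ne_zero_iff.2 h), one_smul]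
  have hpair : ∀ z : ℂ, (pairing A fun j => (ξ j : ℂ)) + z • (pairing A fun j => (ω j : ℂ)) =
      pairing A fun j => (ξ j : ℂ) + z * ω j := fun z => (pairing_add_smul A _ _ z).symm
  have hPL := norm_exp_sub_smul_le_of_forall_real (pairing A fun j => (ξ j : ℂ))
    (pairing A fun j => (ω j : ℂ)) (K := K) (R := 1 + ‖ξ‖) (by simp) k (fun x => by
      have h1 : (pairing A fun j => (ξ j : ℂ)) + (x : ℂ) • (pairing A fun j => (ω j : ℂ)) =
          pairing A fun j => ((ξ + x • ω) j : ℂ) := by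
        rw [hpair]; simp
      rw [h1]
      refine (hA.norm_exp_pairing_le hN _).trans ?_
      have h2 : ‖ξ + x • ω‖ ≤ ‖ξ‖ + |x| := by
        refine (norm_add_le _ _).trans ?_
        rw [norm_smul, Real.norm_eq_abs]
        nlinarith [abs_nonneg x]
      rw [add_assoc]
      gcongr) (norm_nonneg η)
  have h1 : (pairing A fun j => (ξ j : ℂ) + I * (η j : ℂ)) =
      (pairing A fun j => (ξ j : ℂ)) + (I * (‖η‖ : ℝ)) • (pairing A fun j => (ω j : ℂ)) := by
    rw [hpair]
    congr 1
    ext j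
    have : η j = ‖η‖ * ω j := by conv_lhs => rw [hη]; simp
    rw [this]; push_cast; ring
  rw [h1]
  refine hPL.trans ?_
  have h2 : 1 + ‖ξ‖ + ‖η‖ ≤ (1 + ‖ξ‖) * (1 + ‖η‖) := by
    nlinarith [mul_nonneg (norm_nonneg ξ) (norm_nonneg η)]
  have h3 : ‖pairing A fun j => (ω j : ℂ)‖ ≤ tupleNorm A :=
    (norm_pairing_ofReal_le A ω).trans (mul_le_of_le_one_right hA0 hω)
  calc _ ≤ K * 2 ^ k * ((1 + ‖ξ‖) * (1 + ‖η‖)) ^ k * Real.exp (tupleNorm A * ‖η‖) := by gcongr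
    _ = K * 2 ^ k * (1 + ‖ξ‖) ^ k * Real.exp (tupleNorm A * ‖η‖) * (1 + ‖η‖) ^ k := by
      rw [mul_pow]; ring
    _ ≤ K * 2 ^ k * (1 + ‖ξ‖) ^ k * Real.exp (tupleNorm A * ‖η‖) *
        ((1 + k / δ) ^ k * Real.exp (δ * ‖η‖)) := by
      gcongr
      exact pow_mul_exp_le hδ k (norm_nonneg η)
    _ = K * 2 ^ k * (1 + k / δ) ^ k * (1 + ‖ξ‖) ^ k *
        (Real.exp (tupleNorm A * ‖η‖) * Real.exp (δ * ‖η‖)) := by ring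
    _ = _ := by
      rw [← Real.exp_add, ← add_mul, add_sub_cancel]

end Pairing

/-! ### Holomorphic parameter integrals and existence of the calculus. -/

theorem differentiable_integral_of_forall_norm_le {α E : Type*} [MeasurableSpace α]
    {μ : Measure α} [NormedAddCommGroup E] [NormedSpace ℂ E] {F : ℂ → α → E}
    (hmeas : ∀ z, AEStronglyMeasurable (F z) μ) (hdiff : ∀ a, Differentiable ℂ fun z => F z a)
    (hbound : ∀ R : ℝ, ∃ g : α → ℝ, Integrable g μ ∧ ∀ z, ‖z‖ ≤ R → ∀ a, ‖F z a‖ ≤ g a) :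
    Differentiable ℂ fun z => ∫ a, F z a ∂μ := by
  intro z
  -- Cauchy's estimate on unit circles centred in the unit ball around `z` dominates the derivative,
  -- hence radius `2`.
  obtain ⟨g, hg, hFg⟩ := hbound (‖z‖ + 2)
  have hn : ∀ w ∈ Metric.closedBall z 2, ‖w‖ ≤ ‖z‖ + 2 := fun w hw => by
    have := norm_le_norm_add_norm_sub' w z
    rw [Metric.mem_closedBall, dist_eq_norm] at hw
    linarith
  have hd : ∀ a, HasDerivAt (fun w => F w a) (deriv (fun w => F w a) z) z := fun a =>
    (hdiff a z).hasDerivAt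
  refine (hasDerivAt_integral_of_dominated_loc_of_deriv_le (𝕜 := ℂ) (F := F)
    (F' := fun w a => deriv (fun w => F w a) w) (bound := g)
    (Metric.ball_mem_nhds z one_pos) (.of_forall hmeas)
    (hg.mono' (hmeas z) (.of_forall (hFg z (by linarith)))) ?_ ?_ hg ?_).2.differentiableAt
  · have hseq : Filter.Tendsto (fun m : ℕ => z + ((m : ℂ) + 1)⁻¹) Filter.atTop (nhdsWithin z {z}ᶜ) := by
      refine tendsto_nhdsWithin_iff.2 ⟨?_, .of_forall fun m => ?_⟩
      · simpa using (tendsto_one_div_add_atTop_nhds_zero_nat (𝕜 := ℂ)).const_add z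
      · simpa using Nat.cast_add_one_ne_zero m
    refine aestronglyMeasurable_of_tendsto_ae Filter.atTop
      (f := fun (m : ℕ) a => slope (fun w => F w a) z (z + ((m : ℂ) + 1)⁻¹)) (fun m => ?_)
      (.of_forall fun a => (hasDerivAt_iff_tendsto_slope.1 (hd a)).comp hseq)
    simp only [slope_def_module]
    exact ((hmeas _).sub (hmeas _)).const_smul _
  · refine .of_forall fun a w hw => ?_
    have := Complex.norm_deriv_le_of_forall_mem_sphere_norm_le (c := w) (R := 1) (C := g a)
      (f := fun w => F w a) one_pos (hdiff a).diffContOnCl (fun u hu => hFg u (hn u ?_) a)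
    · simpa using this
    · rw [Metric.mem_closedBall]
      rw [Metric.mem_ball] at hw
      rw [Metric.mem_sphere] at hu
      linarith [dist_triangle u w z]
  · exact .of_forall fun a w _ => (hdiff a w).hasDerivAt

theorem SchwartzMap.exists_clm_eq_integral_smul {E F : Type*} [NormedAddCommGroup E]
    [NormedSpace ℝ E] [FiniteDimensional ℝ E] [MeasurableSpace E] [BorelSpace E]
    (μ : Measure E) [μ.IsAddHaarMeasure]
    [NormedAddCommGroup F] [NormedSpace ℂ F] {M : E → F} (hM : Continuous M) {C : ℝ} {k : ℕ}
    (hC : ∀ x, ‖M x‖ ≤ C * (1 + ‖x‖) ^ k) :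
    ∃ T : 𝓢(E, ℂ) →L[ℂ] F, ∀ g : 𝓢(E, ℂ),
      Integrable (fun x => g x • M x) μ ∧ T g = ∫ x, g x • M x ∂μ := by
  -- One power more than the dimension makes `(1 + ‖x‖)^{-d}` integrable.
  set d := Module.finrank ℝ E + 1 with hd
  have hC0 : 0 ≤ C := by simpa using (norm_nonneg _).trans (hC 0)
  have hint : Integrable (fun x : E => (1 + ‖x‖) ^ (-(d : ℝ))) μ :=
    integrable_one_add_norm (by rw [hd]; push_cast; linarith)
  set s : Finset (ℕ × ℕ) := Finset.Iic (k + d, 0)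
  have hle : ∀ (g : 𝓢(E, ℂ)) x, ‖g x • M x‖ ≤ (1 + ‖x‖) ^ (-(d : ℝ)) *
      (C * 2 ^ (k + d) * s.sup (schwartzSeminormFamily ℂ E ℂ) g) := by
    intro g x
    have h1 : (1 + ‖x‖) ^ (k + d) * ‖g x‖ ≤ 2 ^ (k + d) * s.sup (schwartzSeminormFamily ℂ E ℂ) g := by
      have := SchwartzMap.one_add_le_sup_seminorm_apply (𝕜 := ℂ) (m := (k + d, 0)) (k := k + d)
        (n := 0) le_rfl le_rfl g x
      rwa [norm_iteratedFDeriv_zero] at this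
    rw [Real.rpow_neg (by positivity), Real.rpow_natCast, ← div_eq_inv_mul,
      le_div_iff₀ (by positivity), norm_smul]
    calc ‖g x‖ * ‖M x‖ * (1 + ‖x‖) ^ d ≤ ‖g x‖ * (C * (1 + ‖x‖) ^ k) * (1 + ‖x‖) ^ d := by
          gcongr; exact hC x
      _ = C * ((1 + ‖x‖) ^ (k + d) * ‖g x‖) := by rw [pow_add]; ring
      _ ≤ C * (2 ^ (k + d) * s.sup (schwartzSeminormFamily ℂ E ℂ) g) := by gcongr
      _ = _ := by ring
  have hI : ∀ g : 𝓢(E, ℂ), Integrable (fun x => g x • M x) μ := fun g =>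
    (hint.mul_const _).mono' (g.continuous.smul hM).aestronglyMeasurable (.of_forall (hle g))
  refine ⟨SchwartzMap.mkCLMtoNormedSpace (𝕜 := ℂ) (σ := RingHom.id ℂ)
    (fun g => ∫ x, g x • M x ∂μ) (fun f g => ?_) (fun a f => ?_)
    ⟨s, (∫ x, (1 + ‖x‖) ^ (-(d : ℝ)) ∂μ) * (C * 2 ^ (k + d)), by positivity, fun g => ?_⟩,
    fun g => ⟨hI g, rfl⟩⟩
  · simp only [_root_.add_apply, add_smul]
    exact integral_add (hI f) (hI g)
  · simp only [_root_.smul_apply, smul_assoc, RingHom.id_apply]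
    exact integral_smul _ _
  · rw [mul_assoc, ← integral_mul_const]
    exact norm_integral_le_of_norm_le (hint.mul_const _) (.of_forall (hle g))

/-- The Fourier transform `f ↦ f̂` of `fourierHat`, as a continuous linear map. -/
theorem exists_clm_eq_fourierHat (n : ℕ) :
    ∃ T : 𝓢(EuclideanSpace ℝ (Fin n), ℂ) →L[ℂ] 𝓢(EuclideanSpace ℝ (Fin n), ℂ),
      ∀ f ξ, T f ξ = fourierHat f ξ := by
  -- The rescaling removes the `2π` in the exponent of Mathlib's Fourier transform.
  set c : ℝ := (2 * Real.pi)⁻¹ with hc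
  have hc0 : c ≠ 0 := by positivity
  refine ⟨SchwartzMap.compCLMOfContinuousLinearEquiv ℂ
    (LinearEquiv.smulOfNeZero ℝ (EuclideanSpace ℝ (Fin n)) c hc0).toContinuousLinearEquiv ∘L
      SchwartzMap.fourierTransformCLM ℂ, fun f ξ => ?_⟩
  simp only [ContinuousLinearMap.comp_apply, SchwartzMap.compCLMOfContinuousLinearEquiv_apply,
    SchwartzMap.fourierTransformCLM_apply, Function.comp_apply]
  change FourierTransform.fourier (f : EuclideanSpace ℝ (Fin n) → ℂ) (c • ξ) = _
  rw [Real.fourier_eq', fourierHat]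
  refine integral_congr_ae (.of_forall fun x => ?_)
  simp only [smul_eq_mul, inner_smul_right]
  congr 2
  rw [hc]
  push_cast
  field_simp

theorem continuous_exp_I_smul_pairing {n N : ℕ} (A : Fin n → Matrix (Fin N) (Fin N) ℂ) :
    Continuous fun ζ : Fin n → ℂ => NormedSpace.exp (I • pairing A ζ) := by
  let _ : NormedAlgebra ℚ (Matrix (Fin N) (Fin N) ℂ) := NormedAlgebra.restrictScalars ℚ ℂ _
  have h : Continuous fun ζ : Fin n → ℂ => I • pairing A ζ := by unfold pairing; fun_prop
  exact NormedSpace.exp_continuous.comp h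

theorem WeylCalculus.IsHyperbolic.exists_isWeylCalculus {n N : ℕ} (hN : 1 ≤ N)
    {A : Fin n → Matrix (Fin N) (Fin N) ℂ} (hA : IsHyperbolic A) :
    ∃ W : 𝓢'(EuclideanSpace ℝ (Fin n), Matrix (Fin N) (Fin N) ℂ), IsWeylCalculus A W := by
  obtain ⟨T, hT⟩ := exists_clm_eq_fourierHat n
  obtain ⟨S, hS⟩ := SchwartzMap.exists_clm_eq_integral_smul
    (volume : Measure (EuclideanSpace ℝ (Fin n)))
    (M := fun ξ => NormedSpace.exp (I • pairing A fun j => (ξ j : ℂ)))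
    ((continuous_exp_I_smul_pairing A).comp (by fun_prop)) (hA.norm_exp_pairing_le hN)
  refine ⟨ContinuousLinearMap.toPointwiseConvergenceCLM _ _ _ _
    (((2 * Real.pi : ℂ) ^ n)⁻¹ • (S ∘L T)), fun f => ?_⟩
  have h := hS (T f)
  simp only [hT] at h
  refine ⟨h.1, ?_⟩
  rw [show (∫ ξ, weylIntegrand A f ξ) = S (T f) from h.2.symm]
  rfl

/-! ### Paley–Wiener estimates for compactly supported test functions. -/

section FourierLaplace

variable {n : ℕ}

/-- The Fourier–Laplace transform `ζ ↦ ∫ e^{-i⟨x, ζ⟩} f(x) dx`, for `ζ ∈ ℂⁿ`. -/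
noncomputable def fourierLaplace (f : 𝓢(EuclideanSpace ℝ (Fin n), ℂ)) (ζ : Fin n → ℂ) : ℂ :=
  ∫ x : EuclideanSpace ℝ (Fin n), Complex.exp (-(I * ∑ j, x j * ζ j)) * f x

theorem fourierLaplace_ofReal (f : 𝓢(EuclideanSpace ℝ (Fin n), ℂ)) (ξ : EuclideanSpace ℝ (Fin n)) :
    fourierLaplace f (fun j => (ξ j : ℂ)) = fourierHat f ξ := by
  unfold fourierLaplace fourierHat
  congr! 6 with x
  rw [PiLp.inner_apply]
  push_cast
  exact Finset.sum_congr rfl fun j _ => by simp [mul_comm]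

theorem integrable_exp_mul_of_hasCompactSupport {f : 𝓢(EuclideanSpace ℝ (Fin n), ℂ)}
    (hf : HasCompactSupport f) (ζ : Fin n → ℂ) :
    Integrable fun x : EuclideanSpace ℝ (Fin n) => Complex.exp (-(I * ∑ j, x j * ζ j)) * f x :=
  Continuous.integrable_of_hasCompactSupport (by fun_prop) hf.mul_left

theorem fourierLaplace_lineDerivOp {f : 𝓢(EuclideanSpace ℝ (Fin n), ℂ)}
    (hf : HasCompactSupport f) (ζ : Fin n → ℂ) (j : Fin n) :
    fourierLaplace (∂_{EuclideanSpace.single j (1 : ℝ)} f) ζ = I * ζ j * fourierLaplace f ζ := by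
  set e : EuclideanSpace ℝ (Fin n) → ℂ := fun x => Complex.exp (-(I * ∑ j, x j * ζ j)) with he
  have hdiff : Differentiable ℝ e := by fun_prop
  have hder : ∀ x, fderiv ℝ e x (EuclideanSpace.single j 1) = -(I * ζ j) * e x := by
    intro x
    rw [← (hdiff x).lineDeriv_eq_fderiv]
    refine HasLineDerivAt.lineDeriv ?_
    have h1 : (fun t : ℝ => e (x + t • EuclideanSpace.single j 1)) =
        fun t : ℝ => Complex.exp (-(I * (∑ i, x i * ζ i + t * ζ j))) := by
      ext t
      have h0 : ∑ i, (((EuclideanSpace.single j (1 : ℝ)) i : ℝ) : ℂ) * ζ i = ζ j := by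
        rw [Finset.sum_eq_single j (fun i _ hi => by simp [hi]) (by simp)]
        simp
      simp only [he, PiLp.add_apply, PiLp.smul_apply, smul_eq_mul, ofReal_add, ofReal_mul, add_mul,
        Finset.sum_add_distrib, mul_assoc, ← Finset.mul_sum, h0]
    have h2 : HasDerivAt (fun t : ℝ => -(I * (∑ i, x i * ζ i + t * ζ j))) (-(I * ζ j)) 0 := by
      have := (((Complex.ofRealCLM.hasDerivAt (x := 0)).mul_const (ζ j)).const_add
        (∑ i, x i * ζ i)).const_mul I |>.neg
      simpa [Pi.neg_def] using this
    unfold HasLineDerivAt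
    rw [h1]
    have := h2.cexp
    simpa [he, mul_comm] using this
  have hf' : HasCompactSupport (∂_{EuclideanSpace.single j (1 : ℝ)} f :
      𝓢(EuclideanSpace ℝ (Fin n), ℂ)) :=
    hf.of_isClosed_subset (isClosed_tsupport _) (SchwartzMap.tsupport_lineDerivOp_subset _ f)
  have hint := integrable_exp_mul_of_hasCompactSupport hf ζ
  have key := integral_mul_fderiv_eq_neg_fderiv_mul_of_integrable (𝕜 := ℂ)
    (μ := (volume : Measure (EuclideanSpace ℝ (Fin n))))
    (f := e) (g := f) (v := EuclideanSpace.single j 1) ?_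
    (integrable_exp_mul_of_hasCompactSupport hf' ζ) hint (fun x _ => hdiff x)
    (fun x _ => f.differentiableAt)
  · rw [fourierLaplace]
    refine key.trans ?_
    simp only [hder, mul_assoc, integral_const_mul, fourierLaplace, neg_mul, integral_neg, neg_neg]
    rfl
  · simp only [hder, mul_assoc]
    simpa [mul_assoc] using hint.const_mul (-(I * ζ j))

theorem norm_fourierLaplace_le {f : 𝓢(EuclideanSpace ℝ (Fin n), ℂ)} {ζ : Fin n → ℂ} {e : ℝ}
    (h : ∀ x ∈ tsupport f, ∑ j, x j * (ζ j).im ≤ e) :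
    ‖fourierLaplace f ζ‖ ≤ Real.exp e * ∫ x, ‖f x‖ := by
  rw [← integral_const_mul]
  refine norm_integral_le_of_norm_le (f.integrable.norm.const_mul _) (.of_forall fun x => ?_)
  rw [norm_mul]
  by_cases hx : x ∈ tsupport f
  · gcongr
    rw [Complex.norm_exp]
    refine Real.exp_le_exp.2 ((le_of_eq ?_).trans (h x hx))
    simp
  · simp [image_eq_zero_of_notMem_tsupport hx]

/-- Differentiation does not enlarge the support, so the same exponent `e` serves every derivative,
and `C` depends on neither `ζ` nor `e`. -/
theorem norm_pow_mul_fourierLaplace_le {f : 𝓢(EuclideanSpace ℝ (Fin n), ℂ)}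
    (hf : HasCompactSupport f) (j : Fin n) (m : ℕ) :
    ∃ C : ℝ, 0 ≤ C ∧ ∀ (ζ : Fin n → ℂ) (e : ℝ), (∀ x ∈ tsupport f, ∑ j, x j * (ζ j).im ≤ e) →
      ‖ζ j‖ ^ m * ‖fourierLaplace f ζ‖ ≤ C * Real.exp e := by
  induction m generalizing f with
  | zero =>
    refine ⟨∫ x, ‖f x‖, by positivity, fun ζ e h => ?_⟩
    simpa [mul_comm] using norm_fourierLaplace_le h
  | succ m ih =>
    have hsub := SchwartzMap.tsupport_lineDerivOp_subset (EuclideanSpace.single j (1 : ℝ)) f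
    obtain ⟨C, hC0, hC⟩ := ih (hf.of_isClosed_subset (isClosed_tsupport _) hsub)
    refine ⟨C, hC0, fun ζ e h => ?_⟩
    have := hC ζ e fun x hx => h x (hsub hx)
    rw [fourierLaplace_lineDerivOp hf] at this
    simpa [pow_succ, mul_assoc] using this

theorem one_add_norm_pow_le (ξ : EuclideanSpace ℝ (Fin n)) (m : ℕ) :
    (1 + ‖ξ‖) ^ m ≤ (n + 1) ^ m * (1 + ∑ j, |ξ j| ^ m) := by
  -- `a` is the maximum of `1` and the `|ξ j|`.
  obtain ⟨a, ha, hmax⟩ : ∃ a : ℝ, (1 ≤ a ∧ a ^ m ≤ 1 + ∑ j, |ξ j| ^ m) ∧ ∀ j, |ξ j| ≤ a := by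
    by_cases h : ∃ i, 1 ≤ |ξ i| ∧ ∀ j, |ξ j| ≤ |ξ i|
    · obtain ⟨i, hi, h⟩ := h
      refine ⟨|ξ i|, ⟨hi, ?_⟩, h⟩
      have := Finset.single_le_sum (f := fun j => |ξ j| ^ m) (fun j _ => by positivity)
        (Finset.mem_univ i)
      simp only at this
      linarith
    · refine ⟨1, ⟨le_rfl, ?_⟩, fun j => ?_⟩
      · have : 0 ≤ ∑ j, |ξ j| ^ m := by positivity
        simpa
      · by_contra! hj
        have : Nonempty (Fin n) := ⟨j⟩
        obtain ⟨i, hi⟩ := Finite.exists_max fun j => |ξ j|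
        exact h ⟨i, hj.le.trans (hi j), hi⟩
  have h1 : ‖ξ‖ ≤ n * a := by
    have : ‖ξ‖ ≤ ∑ j, |ξ j| := by
      rw [EuclideanSpace.norm_eq]
      refine Real.sqrt_le_iff.2 ⟨by positivity, ?_⟩
      simpa using Finset.sum_sq_le_sq_sum_of_nonneg (s := Finset.univ) (f := fun j => |ξ j|) (fun j _ => abs_nonneg _)
    refine this.trans ((Finset.sum_le_sum fun j _ => hmax j).trans_eq ?_)
    simp
  calc (1 + ‖ξ‖) ^ m ≤ ((n + 1) * a) ^ m := by
        gcongr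
        nlinarith [ha.1]
    _ = (n + 1) ^ m * a ^ m := mul_pow _ _ _
    _ ≤ _ := by gcongr; exact ha.2

theorem one_add_norm_pow_mul_fourierLaplace_le {f : 𝓢(EuclideanSpace ℝ (Fin n), ℂ)}
    (hf : HasCompactSupport f) (m : ℕ) :
    ∃ C : ℝ, 0 ≤ C ∧ ∀ (ξ η : EuclideanSpace ℝ (Fin n)) (e : ℝ),
      (∀ x ∈ tsupport f, inner ℝ x η ≤ e) →
      (1 + ‖ξ‖) ^ m * ‖fourierLaplace f fun j => (ξ j : ℂ) + I * η j‖ ≤ C * Real.exp e := by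
  choose C hC0 hC using fun j => norm_pow_mul_fourierLaplace_le hf j m
  set C' : ℝ := ∫ x, ‖f x‖
  have hC' : 0 ≤ C' := by positivity
  have hS : 0 ≤ ∑ j, C j := Finset.sum_nonneg fun j _ => hC0 j
  refine ⟨(n + 1) ^ m * (C' + ∑ j, C j), by positivity, fun ξ η e he => ?_⟩
  set ζ : Fin n → ℂ := fun j => (ξ j : ℂ) + I * η j with hζ
  have he' : ∀ x ∈ tsupport f, ∑ j, x j * (ζ j).im ≤ e := fun x hx => by
    refine (le_of_eq ?_).trans (he x hx)
    rw [PiLp.inner_apply]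
    exact Finset.sum_congr rfl fun j _ => by simp [hζ, mul_comm]
  have hre : ∀ j, |ξ j| ≤ ‖ζ j‖ := fun j => by
    simpa [hζ] using Complex.abs_re_le_norm (ζ j)
  calc (1 + ‖ξ‖) ^ m * ‖fourierLaplace f ζ‖
      ≤ ((n + 1) ^ m * (1 + ∑ j, |ξ j| ^ m)) * ‖fourierLaplace f ζ‖ := by
        gcongr; exact one_add_norm_pow_le ξ m
    _ = (n + 1) ^ m * (‖fourierLaplace f ζ‖ + ∑ j, |ξ j| ^ m * ‖fourierLaplace f ζ‖) := by
        rw [← Finset.sum_mul]; ring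
    _ ≤ (n + 1) ^ m * (Real.exp e * C' + ∑ j, C j * Real.exp e) := by
        gcongr ((n : ℝ) + 1) ^ m * (?_ + ?_)
        · exact norm_fourierLaplace_le he'
        · refine Finset.sum_le_sum fun j _ => le_trans ?_ (hC j ζ e he')
          gcongr
          exact hre j
    _ = _ := by rw [← Finset.sum_mul]; ring

theorem differentiable_fourierLaplace_line {f : 𝓢(EuclideanSpace ℝ (Fin n), ℂ)}
    (hf : HasCompactSupport f) (ξ ω : EuclideanSpace ℝ (Fin n)) :
    Differentiable ℂ fun z : ℂ => fourierLaplace f fun j => (ξ j : ℂ) + z * ω j := by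
  unfold fourierLaplace
  refine differentiable_integral_of_forall_norm_le
    (fun z => (integrable_exp_mul_of_hasCompactSupport hf _).aestronglyMeasurable)
    (fun x => by fun_prop) fun R => ?_
  refine ⟨fun x => Real.exp (R * ‖inner ℝ x ω‖) * ‖f x‖,
    Continuous.integrable_of_hasCompactSupport (by fun_prop) hf.norm.mul_left, fun z hz x => ?_⟩
  simp only [norm_mul, Complex.norm_exp]
  gcongr
  have h1 : (-(I * ∑ j, (x j : ℂ) * ((ξ j : ℂ) + z * ω j))).re = z.im * inner ℝ x ω := by
    rw [PiLp.inner_apply]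
    simp only [neg_re, I_mul_re, neg_neg, im_sum, im_ofReal_mul, add_im, ofReal_im, zero_add,
      im_mul_ofReal, RCLike.inner_apply, conj_trivial]
    rw [Finset.mul_sum]
    exact Finset.sum_congr rfl fun j _ => by ring
  rw [h1]
  refine (le_abs_self _).trans ?_
  rw [abs_mul]
  exact mul_le_mul_of_nonneg_right ((Complex.abs_im_le_norm z).trans hz) (abs_nonneg _)

theorem continuous_fourierLaplace {f : 𝓢(EuclideanSpace ℝ (Fin n), ℂ)}
    (hf : HasCompactSupport f) : Continuous (fourierLaplace f) := by
  rw [← continuousOn_univ]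
  refine continuousOn_integral_of_compact_support (k := tsupport f) hf
    (Continuous.continuousOn (by fun_prop)) fun ζ x _ hx => ?_
  rw [image_eq_zero_of_notMem_tsupport hx, mul_zero]

end FourierLaplace

/-! ### Contour shift and the support of the calculus. -/

section Support

variable {n N : ℕ} {A : Fin n → Matrix (Fin N) (Fin N) ℂ}

/-- The holomorphic extension of `weylIntegrand A f` to the complex line `z ↦ ξ + z ω`. -/
noncomputable def weylIntegrandLine (A : Fin n → Matrix (Fin N) (Fin N) ℂ)
    (f : 𝓢(EuclideanSpace ℝ (Fin n), ℂ)) (ω : EuclideanSpace ℝ (Fin n)) (z : ℂ)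
    (ξ : EuclideanSpace ℝ (Fin n)) : Matrix (Fin N) (Fin N) ℂ :=
  (fourierLaplace f fun j => (ξ j : ℂ) + z * ω j) •
    NormedSpace.exp (I • pairing A fun j => (ξ j : ℂ) + z * ω j)

theorem weylIntegrandLine_ofReal (f : 𝓢(EuclideanSpace ℝ (Fin n), ℂ))
    (ω ξ : EuclideanSpace ℝ (Fin n)) (a : ℝ) :
    weylIntegrandLine A f ω a ξ = weylIntegrand A f (ξ + a • ω) := by
  rw [weylIntegrandLine, weylIntegrand, ← fourierLaplace_ofReal]
  simp

theorem differentiable_weylIntegrandLine {f : 𝓢(EuclideanSpace ℝ (Fin n), ℂ)}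
    (hf : HasCompactSupport f) (ω ξ : EuclideanSpace ℝ (Fin n)) :
    Differentiable ℂ fun z => weylIntegrandLine A f ω z ξ := by
  refine (differentiable_fourierLaplace_line hf ξ ω).smul ?_
  have h : ∀ z : ℂ, I • (pairing A fun j => (ξ j : ℂ) + z * ω j) =
      I • (pairing A fun j => (ξ j : ℂ)) + z • (I • pairing A fun j => (ω j : ℂ)) := fun z => by
    rw [smul_comm z, ← smul_add]
    exact congrArg _ (pairing_add_smul A _ _ z)
  simp only [h]
  exact differentiable_exp_add_smul _ _

theorem exists_norm_weylIntegrandLine_le (hN : 1 ≤ N) (hA : IsHyperbolic A)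
    {f : 𝓢(EuclideanSpace ℝ (Fin n), ℂ)} (hf : HasCompactSupport f)
    {ω : EuclideanSpace ℝ (Fin n)} (hω : ‖ω‖ = 1) {r : ℝ} (hr : tupleNorm A < r) (d : ℕ) :
    ∃ K : ℝ, 0 ≤ K ∧ ∀ (z : ℂ) (e : ℝ), (∀ x ∈ tsupport f, z.im * inner ℝ x ω ≤ e) → ∀ ξ,
      ‖weylIntegrandLine A f ω z ξ‖ ≤
        K * Real.exp (e + r * |z.im|) * (1 + ‖ξ + z.re • ω‖) ^ (-(d : ℝ)) := by
  obtain ⟨C, hC0, hC⟩ := hA.exists_norm_exp_pairing_le hN hr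
  obtain ⟨D, hD0, hD⟩ := one_add_norm_pow_mul_fourierLaplace_le hf (N - 1 + d)
  refine ⟨D * C, by positivity, fun z e he ξ => ?_⟩
  have hζ : (fun j => (ξ j : ℂ) + z * ω j) =
      fun j => (((ξ + z.re • ω) j : ℝ) : ℂ) + I * ((z.im • ω) j : ℝ) := by
    ext j
    conv_lhs => rw [← Complex.re_add_im z]
    simp only [PiLp.add_apply, PiLp.smul_apply, smul_eq_mul, ofReal_add, ofReal_mul]
    ring
  have h1 := hC (ξ + z.re • ω) (z.im • ω)
  have h2 := hD (ξ + z.re • ω) (z.im • ω) e fun x hx => by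
    rw [inner_smul_right]; exact he x hx
  rw [norm_smul, hω, mul_one, Real.norm_eq_abs] at h1
  rw [weylIntegrandLine, hζ, norm_smul, Real.rpow_neg (by positivity), Real.rpow_natCast,
    ← div_eq_mul_inv, le_div_iff₀ (by positivity), Real.exp_add]
  set s := 1 + ‖ξ + z.re • ω‖
  set P := ‖fourierLaplace f fun j => (((ξ + z.re • ω) j : ℝ) : ℂ) + I * ((z.im • ω) j : ℝ)‖
  calc _ ≤ P * (C * s ^ (N - 1) * Real.exp (r * |z.im|)) * s ^ d := by gcongr
    _ = s ^ (N - 1 + d) * P * (C * Real.exp (r * |z.im|)) := by rw [pow_add]; ring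
    _ ≤ D * Real.exp e * (C * Real.exp (r * |z.im|)) := by gcongr
    _ = _ := by ring

theorem integral_weylIntegrand_eq_zero (hN : 1 ≤ N) (hA : IsHyperbolic A)
    {f : 𝓢(EuclideanSpace ℝ (Fin n), ℂ)} (hf : HasCompactSupport f)
    {ω : EuclideanSpace ℝ (Fin n)} (hω : ‖ω‖ = 1) {ρ : ℝ} (hρ : tupleNorm A < ρ)
    (hsupp : ∀ x ∈ tsupport f, ρ ≤ inner ℝ x ω) : ∫ ξ, weylIntegrand A f ξ = 0 := by
  obtain ⟨r, hr, hrρ⟩ := exists_between hρ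
  have hr0 : 0 ≤ r := (tupleNorm_nonneg A).trans hr.le
  obtain ⟨b, hb⟩ : ∃ b, ∀ x ∈ tsupport f, ‖x‖ ≤ b := hf.isBounded.exists_norm_le
  have hint : Integrable (fun ξ : EuclideanSpace ℝ (Fin n) => (1 + ‖ξ‖) ^ (-((n + 1 : ℕ) : ℝ))) :=
    integrable_one_add_norm (by simp)
  -- Decay of order `n + 1` is integrable on `ℝⁿ`.
  obtain ⟨K, hK0, hK⟩ := exists_norm_weylIntegrandLine_le hN hA hf hω hr (n + 1)
  set G : ℂ → Matrix (Fin N) (Fin N) ℂ := fun z => ∫ ξ, weylIntegrandLine A f ω z ξ with hG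
  have hline : ∀ z : ℂ, Continuous fun (ξ : EuclideanSpace ℝ (Fin n)) (j : Fin n) =>
      (ξ j : ℂ) + z * ω j := fun z => by fun_prop
  have hdiff : Differentiable ℂ G := by
    refine differentiable_integral_of_forall_norm_le (fun z => ?_)
      (differentiable_weylIntegrandLine hf ω) fun R => ?_
    · exact (((continuous_fourierLaplace hf).comp (hline z)).smul
        ((continuous_exp_I_smul_pairing A).comp (hline z))).aestronglyMeasurable
    · refine ⟨fun ξ => K * Real.exp (R * b + r * R) * (1 + R) ^ (n + 1) *
        (1 + ‖ξ‖) ^ (-((n + 1 : ℕ) : ℝ)), hint.const_mul _, fun z hz ξ => ?_⟩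
      have him := (Complex.abs_im_le_norm z).trans hz
      have hre := (Complex.abs_re_le_norm z).trans hz
      have hR : 0 ≤ R := (abs_nonneg _).trans him
      refine (hK z (R * b) (fun x hx => ?_) ξ).trans ?_
      · have h1 : |inner ℝ x ω| ≤ b := by
          refine (abs_real_inner_le_norm x ω).trans ?_
          rw [hω, mul_one]; exact hb x hx
        refine (le_abs_self _).trans ?_
        rw [abs_mul]
        gcongr
      · have h2 : (1 + ‖ξ + z.re • ω‖) ^ (-((n + 1 : ℕ) : ℝ)) ≤
            (1 + R) ^ (n + 1) * (1 + ‖ξ‖) ^ (-((n + 1 : ℕ) : ℝ)) := by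
          rw [Real.rpow_neg (by positivity), Real.rpow_neg (by positivity), Real.rpow_natCast,
            Real.rpow_natCast, ← div_eq_mul_inv, inv_le_comm₀ (by positivity) (by positivity),
            inv_div, div_le_iff₀ (by positivity), ← mul_pow]
          gcongr
          have h3 : ‖ξ‖ ≤ ‖ξ + z.re • ω‖ + R := by
            have := norm_sub_le (ξ + z.re • ω) (z.re • ω)
            rw [add_sub_cancel_right, norm_smul, hω, mul_one, Real.norm_eq_abs] at this
            linarith
          nlinarith [norm_nonneg (ξ + z.re • ω)]
        calc _ ≤ K * Real.exp (R * b + r * R) *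
              ((1 + R) ^ (n + 1) * (1 + ‖ξ‖) ^ (-((n + 1 : ℕ) : ℝ))) := by gcongr
          _ = _ := by ring
  -- Real shifts are translations of Lebesgue measure; the identity theorem then makes the entire
  -- function `G` constant.
  have hreal : ∀ a : ℝ, G a = ∫ ξ, weylIntegrand A f ξ := fun a => by
    simp only [hG, weylIntegrandLine_ofReal]
    exact integral_add_right_eq_self (weylIntegrand A f) _
  have hconst : G = fun _ => ∫ ξ, weylIntegrand A f ξ := by
    have hseq : Filter.Tendsto (fun m : ℕ => ((1 / ((m : ℝ) + 1) : ℝ) : ℂ)) Filter.atTop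
        (nhdsWithin 0 {0}ᶜ) := by
      refine tendsto_nhdsWithin_iff.2 ⟨?_, .of_forall fun m => ?_⟩
      · simpa using tendsto_one_div_add_atTop_nhds_zero_nat (𝕜 := ℂ)
      · simpa using Nat.cast_add_one_ne_zero m
    exact AnalyticOnNhd.eq_of_frequently_eq (fun z _ => hdiff.analyticAt z)
      (fun z _ => analyticAt_const)
      (hseq.frequently (Filter.Frequently.of_forall fun m => hreal _))
  have hle : ∀ t : ℝ, 0 ≤ t → ‖∫ ξ, weylIntegrand A f ξ‖ ≤ K * Real.exp ((r - ρ) * t) *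
      ∫ ξ : EuclideanSpace ℝ (Fin n), (1 + ‖ξ‖) ^ (-((n + 1 : ℕ) : ℝ)) := fun t ht => by
    -- At `z = -it` the Fourier–Laplace factor gains `e^{-tρ}` and the matrix exponential loses at
    -- most `e^{rt}`, up to constants and polynomial factors.
    rw [← congrFun hconst (-(t * I)), ← integral_const_mul]
    refine norm_integral_le_of_norm_le (hint.const_mul _) (.of_forall fun ξ => ?_)
    have := hK (-(t * I)) (-(t * ρ)) (fun x hx => by simpa using mul_le_mul_of_nonneg_left (hsupp x hx) ht) ξ
    simp only [neg_im, mul_im, ofReal_re, I_im, mul_one, ofReal_im, I_re, mul_zero, add_zero,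
      abs_neg, abs_of_nonneg ht, neg_re, mul_re, sub_self, neg_zero, zero_smul] at this
    refine this.trans (le_of_eq ?_)
    congr 3
    ring
  have hlim : Filter.Tendsto (fun t : ℝ => K * Real.exp ((r - ρ) * t) *
      ∫ ξ : EuclideanSpace ℝ (Fin n), (1 + ‖ξ‖) ^ (-((n + 1 : ℕ) : ℝ))) Filter.atTop (nhds 0) := by
    have h := Real.tendsto_exp_atBot.comp
      (Filter.tendsto_id.const_mul_atTop_of_neg (sub_neg.2 hrρ))
    simpa using (h.const_mul K).mul_const
      (∫ ξ : EuclideanSpace ℝ (Fin n), (1 + ‖ξ‖) ^ (-((n + 1 : ℕ) : ℝ)))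
  refine norm_le_zero_iff.1 (ge_of_tendsto hlim ?_)
  filter_upwards [Filter.eventually_ge_atTop 0] with t ht using hle t ht

theorem WeylCalculus.IsWeylCalculus.dsupport_subset (hN : 1 ≤ N) (hA : IsHyperbolic A)
    {W : 𝓢'(EuclideanSpace ℝ (Fin n), Matrix (Fin N) (Fin N) ℂ)} (hW : IsWeylCalculus A W) :
    Distribution.dsupport W ⊆ Metric.closedBall 0 (tupleNorm A) := by
  intro x₀ hx₀
  by_contra hx
  rw [mem_closedBall_zero_iff, not_le] at hx
  obtain ⟨ρ, hρ, hρx⟩ := exists_between hx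
  have hpos : 0 < ‖x₀‖ := (tupleNorm_nonneg A).trans_lt hx
  set ω : EuclideanSpace ℝ (Fin n) := ‖x₀‖⁻¹ • x₀ with hω
  have hω1 : ‖ω‖ = 1 := by
    rw [hω, norm_smul, norm_inv, norm_norm, inv_mul_cancel₀ hpos.ne']
  -- A half-space separates `x₀` from the ball; cutting it with a bounded ball forces compact
  -- support on the test functions.
  refine (Distribution.notMem_dsupport_iff x₀).2 ⟨{x | ρ < inner ℝ x ω} ∩ Metric.ball x₀ 1,
    fun f hf => ?_, ?_, ?_, Metric.mem_ball_self one_pos⟩ hx₀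
  · have hcomp : HasCompactSupport f :=
      Metric.isCompact_of_isClosed_isBounded (isClosed_tsupport _)
        (Metric.isBounded_ball.subset fun x hx => (hf hx).2)
    rw [(hW f).2, integral_weylIntegrand_eq_zero hN hA hcomp hω1 hρ fun x hx => (hf hx).1.le,
      smul_zero]
  · exact (isOpen_lt (by fun_prop) (by fun_prop)).inter Metric.isOpen_ball
  · change ρ < inner ℝ x₀ ω
    rw [hω, inner_smul_right, real_inner_self_eq_norm_sq, pow_two, inv_mul_cancel_left₀ hpos.ne']
    exact hρx

end Support

end

theorem mainTheorem2 {n N : ℕ} (hN : 1 ≤ N) (A : Fin n → Matrix (Fin N) (Fin N) ℂ)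
    (hA : IsHyperbolic A) :
    (∀ r : ℝ, tupleNorm A < r → ∃ C : ℝ, 0 < C ∧
      ∀ ξ η : EuclideanSpace ℝ (Fin n),
        ‖NormedSpace.exp (Complex.I • pairing A fun j => (ξ j : ℂ) + Complex.I * (η j : ℂ))‖
          ≤ C * (1 + ‖ξ‖) ^ (N - 1) * Real.exp (r * ‖η‖)) ∧
    ∃ W : 𝓢'(EuclideanSpace ℝ (Fin n), Matrix (Fin N) (Fin N) ℂ),
      IsWeylCalculus A W ∧
      IsCompact (Distribution.dsupport W) ∧
      ∀ r : ℝ, tupleNorm A < r →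
        Distribution.dsupport W ⊆ Metric.closedBall (0 : EuclideanSpace ℝ (Fin n)) r := by
  obtain ⟨W, hW⟩ := hA.exists_isWeylCalculus hN
  have hsub := hW.dsupport_subset hN hA
  exact ⟨fun r hr => hA.exists_norm_exp_pairing_le hN hr, W, hW,
    (isCompact_closedBall _ _).of_isClosed_subset Distribution.isClosed_dsupport hsub,
    fun r hr => hsub.trans (Metric.closedBall_subset_closedBall hr.le)⟩
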